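/- Let $(R,\mathfrak m)$ be a Noetherian local ring of dimension $d$ that is a normal (i.e. integrally closed) domain, and let $\omega_R\subseteq R$ be a canonical ideal of $R$, that is, an ideal which as an $R$-module is a canonical module: $\mathrm{Hom}_R(\omega_R,E_R(R/\mathfrak m))\cong H^d_{\mathfrak m}(R)$, where $E_R(R/\mathfrak m)$ is the injective hull of the residue field. Let $a\in\mathfrak m$ have no square root in $\mathrm{Frac}(R)$. Let $R(a^{1/2})$ denote the $R$-module $R\oplus R$ with the ring structure $$(r,s)(r',s')=(rr'+ss'a,\; rs'+r's),$$ and let $R\oplus\omega_R=\{(r,x): r\in R,\ x\in\omega_R\}$, which is a subring of $R(a^{1/2})$. Call a Noetherian local ring a complete intersection if its completion is isomorphic to a quotient of a regular local ring by an ideal generated by a regular sequence. Then: (i) for every prime ideal $\mathfrak p$ of $R(a^{1/2})$ of height at most $1$, the local ring $R(a^{1/2})_{\mathfrak p}$ is a complete intersection; (ii) for every prime ideal $\mathfrak p'$ of $R\oplus\omega_R$ of height at most $1$, the local ring $(R\oplus\omega_R)_{\mathfrak p'}$ is a complete intersection. -/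

import Mathlib

open IsLocalRing

universe u

/-- `R(a^{1/2})`: the free module `R ⊕ R` with the multiplication
`(r, s) * (r', s') = (r r' + s s' a, r s' + r' s)`.  The pair `(r, s)` is `⟨r, s⟩`, its
coordinates are `re` and `im`. -/
abbrev SqrtExtension (R : Type u) [CommRing R] (a : R) : Type u :=
  QuadraticAlgebra R a 0

/-- The multiplication rule of `R(a^{1/2})`. -/
theorem SqrtExtension.mk_mul_mk {R : Type u} [CommRing R] (a r s r' s' : R) :
    (⟨r, s⟩ : SqrtExtension R a) * ⟨r', s'⟩ = ⟨r * r' + s * s' * a, r * s' + r' * s⟩ := by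
  ext
  · simp; ring
  · simp; ring

/-- For an ideal `I` of `R`, the subring `R ⊕ I = {(r, x) | r ∈ R, x ∈ I}` of `R(a^{1/2})`. -/
def sqrtExtensionSubring {R : Type u} [CommRing R] (a : R) (I : Ideal R) :
    Subring (SqrtExtension R a) where
  carrier := {z | z.im ∈ I}
  mul_mem' {z w} hz hw := by
    have h : (z * w).im = z.re * w.im + w.re * z.im := by simp; ring
    simp only [Set.mem_ofPred_eq] at hz hw ⊢
    rw [h]
    exact I.add_mem (I.mul_mem_left _ hw) (I.mul_mem_left _ hz)
  one_mem' := by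
    change (0 : R) ∈ I
    exact I.zero_mem
  add_mem' {z w} hz hw := by
    simp only [Set.mem_ofPred_eq] at hz hw ⊢
    simpa using I.add_mem hz hw
  zero_mem' := by simp
  neg_mem' {z} hz := by
    simp only [Set.mem_ofPred_eq] at hz ⊢
    simpa using hz

/-- `i : N → E` is an injective hull of the `R`-module `N`: an embedding into an injective
`R`-module that is an essential extension of the image. -/
structure IsInjectiveHull {R : Type u} [CommRing R] {N E : Type u} [AddCommGroup N] [Module R N]
    [AddCommGroup E] [Module R E] (i : N →ₗ[R] E) : Prop where
  injective_module : Module.Injective R E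
  injective_map : Function.Injective i
  essential : ∀ P : Submodule R E, P ≠ ⊥ → P ⊓ LinearMap.range i ≠ ⊥

/-- `M` is a canonical module of the Noetherian local ring `(R, 𝔪)` of dimension `d`: it is
finitely generated, and its Matlis dual `Hom_R(M, E(R/𝔪))` is isomorphic to the top local
cohomology module `H^d_𝔪(R)`.  (By Matlis duality this says that the completion of `M` is
`Hom_R(H^d_𝔪(R), E(R/𝔪))`.)  The injective hull `E(R/𝔪)` is unique up to isomorphism, so any
model of it may be used. -/
def IsCanonicalModule (R : Type u) [CommRing R] [IsLocalRing R]
    (M : Type u) [AddCommGroup M] [Module R M] : Prop :=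
  Module.Finite R M ∧
    ∃ d : ℕ, ringKrullDim R = d ∧
      ∃ (E : Type u) (_ : AddCommGroup E) (_ : Module R E) (i : ResidueField R →ₗ[R] E),
        IsInjectiveHull i ∧
          Nonempty ((M →ₗ[R] E) ≃ₗ[R]
            ((localCohomology (maximalIdeal R) d).obj (ModuleCat.of R R)))

/-- A canonical ideal: an ideal which, as an `R`-module, is a canonical module. -/
def IsCanonicalIdeal {R : Type u} [CommRing R] [IsLocalRing R] (I : Ideal R) : Prop :=
  IsCanonicalModule R I

/-- `A` is a complete intersection local ring: it is Noetherian local, and its completion is the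
quotient of a regular local ring by an ideal generated by a regular sequence. -/
def IsCompleteIntersectionLocalRing (A : Type u) [CommRing A] : Prop :=
  IsNoetherianRing A ∧ ∃ _ : IsLocalRing A,
    ∃ (Q : Type u) (_ : CommRing Q) (_ : IsRegularLocalRing Q) (x : List Q),
      RingTheory.Sequence.IsRegular Q x ∧
        Nonempty ((Q ⧸ Ideal.ofList x) ≃+* AdicCompletion (maximalIdeal A) A)

/-- `B` is locally a complete intersection in codimension `≤ 1`: `B_𝔭` is a complete intersection
for every prime `𝔭` of height at most `1`. -/
def IsLocallyCompleteIntersectionInCodimLEOne (B : Type u) [CommRing B] : Prop :=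
  ∀ (p : Ideal B) [p.IsPrime], p.height ≤ 1 →
    IsCompleteIntersectionLocalRing (Localization.AtPrime p)

/-!
Let `B = R ⊕ I` and let `𝔭` be a prime of `B` of height at most `1`, lying over `𝔮` in `R`. A prime
`𝔓` of `T = R(a^{1/2})` over `𝔭` satisfies `ht 𝔮 ≤ ht 𝔓 ≤ ht 𝔭`: the first inequality is going
down for the free extension `R → T`, the second holds because `B → T` is integral. Hence `D = R_𝔮`
is a principal ideal domain, and `I D = t D`. The localization of `B` at `R \ 𝔮` is `D ⊕ t D`, which
is `D[X] / (X ^ 2 - t ^ 2 a)` if `t ≠ 0` and `D = D[X] / (X)` otherwise: a hypersurface in a regular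
ring. The ring `B_𝔭` is a localization of it, and completing its presentation as a quotient of a
regular local ring by a nonzerodivisor shows that it is a complete intersection.
-/

section AdicCompletion

variable {S A : Type*} [CommRing S] [CommRing A]

theorem pow_le_comap_pow_of_map_le {φ : S →+* A} {I : Ideal S} {J : Ideal A}
    (h : I.map φ ≤ J) (n : ℕ) : I ^ n ≤ (J ^ n).comap φ :=
  Ideal.map_le_iff_le_comap.1 ((Ideal.map_pow φ I n).trans_le (Ideal.pow_right_mono h n))

theorem factorPow_comp_quotientMap_comp_evalₐ {φ : S →+* A} {I : Ideal S} {J : Ideal A}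
    (h : I.map φ ≤ J) {m n : ℕ} (hmn : m ≤ n) :
    (Ideal.Quotient.factorPow J hmn).comp
      ((Ideal.quotientMap (J ^ n) φ (pow_le_comap_pow_of_map_le h n)).comp
        (AdicCompletion.evalₐ I n : AdicCompletion I S →+* S ⧸ I ^ n)) =
      (Ideal.quotientMap (J ^ m) φ (pow_le_comap_pow_of_map_le h m)).comp
        (AdicCompletion.evalₐ I m : AdicCompletion I S →+* S ⧸ I ^ m) := by
  ext x
  obtain ⟨x, rfl⟩ := AdicCompletion.mk_surjective I S x
  simp only [RingHom.comp_apply, RingHom.coe_coe, AdicCompletion.evalₐ_mk, Ideal.quotientMap_mk]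
  change Ideal.Quotient.mk (J ^ m) (φ (x n)) = Ideal.Quotient.mk (J ^ m) (φ (x m))
  rw [Ideal.Quotient.mk_eq_mk_iff_sub_mem, ← map_sub]
  refine pow_le_comap_pow_of_map_le h m ?_
  rw [← Ideal.Quotient.mk_eq_mk_iff_sub_mem]
  exact AdicCompletion.Ideal.mk_eq_mk I hmn x

/-- The ring homomorphism of adic completions induced by `φ : S → A` with `φ(I) ⊆ J`. -/
noncomputable def adicCompletionMap (φ : S →+* A) (I : Ideal S) (J : Ideal A) (h : I.map φ ≤ J) :
    AdicCompletion I S →+* AdicCompletion J A :=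
  AdicCompletion.liftRingHom J
    (fun n ↦ (Ideal.quotientMap (J ^ n) φ (pow_le_comap_pow_of_map_le h n)).comp
      (AdicCompletion.evalₐ I n : AdicCompletion I S →+* S ⧸ I ^ n))
    (factorPow_comp_quotientMap_comp_evalₐ h)

theorem evalₐ_adicCompletionMap_mk {φ : S →+* A} {I : Ideal S} {J : Ideal A} (h : I.map φ ≤ J)
    (n : ℕ) (x : AdicCompletion.AdicCauchySequence I S) :
    AdicCompletion.evalₐ J n (adicCompletionMap φ I J h (AdicCompletion.mk I S x)) =
      Ideal.Quotient.mk (J ^ n) (φ (x n)) :=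
  (AdicCompletion.evalₐ_liftRingHom J _ (factorPow_comp_quotientMap_comp_evalₐ h) n _).trans
    (by simp)

theorem mem_pow_smul_top_iff_mem_map_pow [Algebra S A] (I : Ideal S) (n : ℕ) (z : A) :
    z ∈ (I ^ n • ⊤ : Submodule S A) ↔ z ∈ I.map (algebraMap S A) ^ n := by
  rw [Ideal.smul_top_eq_map, Submodule.restrictScalars_mem, Ideal.map_pow]

/-- This identifies the ring homomorphism `adicCompletionMap` with the `S`-linear map
`AdicCompletion.map I`, whose source and target are completions of `S`-modules, so that the
exactness of completion applies to the former. -/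
theorem evalₐ_adicCompletionMap_eq_mk_iff [Algebra S A] (I : Ideal S) (n : ℕ)
    (x : AdicCompletion I S) (z : A) :
    AdicCompletion.evalₐ (I.map (algebraMap S A)) n
        (adicCompletionMap (algebraMap S A) I _ le_rfl x) = Ideal.Quotient.mk _ z ↔
      (AdicCompletion.map I (Algebra.linearMap S A) x).val n = Submodule.Quotient.mk z := by
  obtain ⟨x, rfl⟩ := AdicCompletion.mk_surjective I S x
  rw [evalₐ_adicCompletionMap_mk, Ideal.Quotient.mk_eq_mk_iff_sub_mem,
    ← mem_pow_smul_top_iff_mem_map_pow, ← Submodule.Quotient.eq]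
  rfl

theorem adicCompletionMap_eq_zero_iff [Algebra S A] (I : Ideal S) (x : AdicCompletion I S) :
    adicCompletionMap (algebraMap S A) I _ le_rfl x = 0 ↔
      AdicCompletion.map I (Algebra.linearMap S A) x = 0 := by
  have eval_eq_zero_iff (n : ℕ) := evalₐ_adicCompletionMap_eq_mk_iff (A := A) I n x 0
  simp only [map_zero, Submodule.Quotient.mk_zero] at eval_eq_zero_iff
  constructor
  · intro h
    ext n
    exact (eval_eq_zero_iff n).1 (by rw [h, map_zero])
  · intro h
    refine AdicCompletion.ext_evalₐ fun n ↦ ?_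
    rw [map_zero]
    exact (eval_eq_zero_iff n).2 (by rw [h]; rfl)

theorem adicCompletionMap_surjective {φ : S →+* A} (hφ : Function.Surjective φ) (I : Ideal S) :
    Function.Surjective (adicCompletionMap φ I _ le_rfl) := by
  algebraize [φ]
  intro y
  obtain ⟨y, rfl⟩ := AdicCompletion.mk_surjective _ A y
  have cauchy (n : ℕ) : y n ≡ y (n + 1) [SMOD (I ^ n • ⊤ : Submodule S A)] := by
    have := y.2 n.le_succ
    rw [SModEq.sub_mem] at this ⊢
    rw [mem_pow_smul_top_iff_mem_map_pow]
    simpa [RingHom.algebraMap_toAlgebra] using this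
  obtain ⟨x, hx⟩ := AdicCompletion.map_surjective I (f := Algebra.linearMap S A) hφ
    (AdicCompletion.mk I A (.mk I A y cauchy))
  refine ⟨x, AdicCompletion.ext_evalₐ fun n ↦ ?_⟩
  rw [AdicCompletion.evalₐ_mk]
  exact (evalₐ_adicCompletionMap_eq_mk_iff I n x (y n)).2 (by rw [hx]; rfl)

theorem range_adicCompletion_map_subtype [IsNoetherianRing S] (I K : Ideal S) :
    LinearMap.range (AdicCompletion.map I K.subtype) =
      K.map (algebraMap S (AdicCompletion I S)) := by
  have map_smul_of (r : AdicCompletion I S) (k : K) :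
      AdicCompletion.map I K.subtype (r • AdicCompletion.of I K k) =
        r * algebraMap S (AdicCompletion I S) k := by
    rw [map_smul, AdicCompletion.map_of]
    rfl
  apply le_antisymm
  · rintro _ ⟨y, rfl⟩
    obtain ⟨y, rfl⟩ := AdicCompletion.ofTensorProduct_surjective_of_finite I K y
    induction y with
    | zero => simpa only [map_zero] using zero_mem _
    | tmul r k =>
      rw [AdicCompletion.ofTensorProduct_tmul, map_smul_of]
      exact Ideal.mul_mem_left _ _ (Ideal.mem_map_of_mem _ k.2)
    | add y z hy hz => simpa only [map_add] using add_mem hy hz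
  · refine Ideal.span_le.2 ?_
    rintro _ ⟨k, hk, rfl⟩
    exact ⟨_, (map_smul_of 1 ⟨k, hk⟩).trans (one_mul _)⟩

theorem ker_adicCompletionMap {S A : Type u} [CommRing S] [CommRing A] [IsNoetherianRing S]
    {φ : S →+* A} (hφ : Function.Surjective φ) (I : Ideal S) :
    RingHom.ker (adicCompletionMap φ I _ le_rfl) =
      (RingHom.ker φ).map (algebraMap S (AdicCompletion I S)) := by
  algebraize [φ]
  have exact_completion := AdicCompletion.map_exact (I := I) (f := (RingHom.ker φ).subtype)
    (g := Algebra.linearMap S A) Subtype.val_injective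
    (fun x ↦ by simp [RingHom.mem_ker, RingHom.algebraMap_toAlgebra]) hφ
  ext x
  rw [← range_adicCompletion_map_subtype, RingHom.mem_ker]
  exact (adicCompletionMap_eq_zero_iff I x).trans (exact_completion x)

theorem isNoetherianRing_adicCompletion [IsNoetherianRing S] (I : Ideal S) :
    IsNoetherianRing (AdicCompletion I S) := by
  obtain ⟨s, rfl⟩ := IsNoetherian.noetherian I
  let φ : MvPolynomial s S →+* S := MvPolynomial.eval (↑)
  have hφ : Function.Surjective φ := fun r ↦ ⟨MvPolynomial.C r, by simp [φ]⟩
  have map_idealOfVars : (MvPolynomial.idealOfVars s S).map φ = Ideal.span s := by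
    rw [MvPolynomial.idealOfVars, Ideal.map_span, ← Set.range_comp]
    congr 1
    ext x
    simp [φ]
  have := isNoetherianRing_of_ringEquiv _
    (MvPowerSeries.toAdicCompletionAlgEquiv s S).toRingEquiv
  have := isNoetherianRing_of_surjective _ _ _
    (adicCompletionMap_surjective hφ (MvPolynomial.idealOfVars s S))
  rwa [map_idealOfVars] at this

theorem isRegularLocalRing_adicCompletion (Q : Type u) [CommRing Q] [IsRegularLocalRing Q] :
    IsRegularLocalRing (AdicCompletion (maximalIdeal Q) Q) := by
  have := isNoetherianRing_adicCompletion (maximalIdeal Q)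
  apply IsRegularLocalRing.of_spanFinrank_maximalIdeal_le
  rw [AdicCompletion.spanFinrank_maximalIdeal_eq, IsRegularLocalRing.spanFinrank_maximalIdeal,
    ← maximalIdeal_height_eq_ringKrullDim, ← maximalIdeal_height_eq_ringKrullDim]
  have : (maximalIdeal (AdicCompletion (maximalIdeal Q) Q)).LiesOver (maximalIdeal Q) :=
    ⟨(IsLocalRing.maximalIdeal_comap _).symm⟩
  rw [Ideal.height_eq_height_add_of_liesOver_of_hasGoingDown (maximalIdeal Q)
    (maximalIdeal (AdicCompletion (maximalIdeal Q) Q))]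
  exact WithBot.coe_le_coe.2 le_self_add

end AdicCompletion

section CompleteIntersection

theorem IsCompleteIntersectionLocalRing.of_surjective {Q A : Type u} [CommRing Q]
    [IsRegularLocalRing Q] [CommRing A] [Nontrivial A] (ψ : Q →+* A) (hψ : Function.Surjective ψ)
    {x : List Q} (hx : RingTheory.Sequence.IsWeaklyRegular Q x)
    (hker : RingHom.ker ψ = Ideal.ofList x) :
    IsCompleteIntersectionLocalRing A := by
  have := IsLocalRing.of_surjective' ψ hψ
  have := isRegularLocalRing_adicCompletion Q
  let C := AdicCompletion (maximalIdeal Q) Q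
  have mem_maximalIdeal : ∀ c ∈ x.map (algebraMap Q C), c ∈ maximalIdeal C := by
    simp only [List.mem_map]
    rintro _ ⟨q, hq, rfl⟩
    rw [AdicCompletion.maximalIdeal_eq_map]
    refine Ideal.mem_map_of_mem _ (le_maximalIdeal (RingHom.ker_ne_top ψ) ?_)
    exact hker ▸ Ideal.subset_span hq
  have regular : RingTheory.Sequence.IsRegular C (x.map (algebraMap Q C)) :=
    .of_isWeaklyRegular_of_mem_maximalIdeal C mem_maximalIdeal (.of_flat hx)
  have ker_completion : Ideal.ofList (x.map (algebraMap Q C)) =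
      RingHom.ker (adicCompletionMap ψ (maximalIdeal Q) _ le_rfl) := by
    rw [ker_adicCompletionMap hψ, hker, Ideal.map_ofList]
  refine ⟨isNoetherianRing_of_surjective _ _ ψ hψ, inferInstance, C, inferInstance, inferInstance,
    x.map (algebraMap Q C), regular, ?_⟩
  rw [← IsLocalRing.map_maximalIdeal_of_surjective ψ hψ]
  exact ⟨(Ideal.quotEquivOfEq ker_completion).trans
    (RingHom.quotientKerEquivOfSurjective (adicCompletionMap_surjective hψ _))⟩

theorem IsCompleteIntersectionLocalRing.of_ringEquiv {A A' : Type u} [CommRing A] [CommRing A']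
    (e : A ≃+* A') (hA : IsCompleteIntersectionLocalRing A) :
    IsCompleteIntersectionLocalRing A' := by
  obtain ⟨_, _, Q, _, _, x, hx, ⟨f⟩⟩ := hA
  have := e.isLocalRing
  have ker_completion :
      RingHom.ker (adicCompletionMap e.toRingHom (maximalIdeal A) _ le_rfl) = ⊥ := by
    rw [ker_adicCompletionMap e.surjective,
      (RingHom.injective_iff_ker_eq_bot e.toRingHom).1 e.injective, Ideal.map_bot]
  refine ⟨isNoetherianRing_of_ringEquiv A e, inferInstance, Q, inferInstance, inferInstance, x, hx,
    ?_⟩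
  rw [← IsLocalRing.map_maximalIdeal_of_surjective e.toRingHom e.surjective]
  exact ⟨f.trans (RingEquiv.ofBijective _ ⟨(RingHom.injective_iff_ker_eq_bot _).2 ker_completion,
    adicCompletionMap_surjective e.surjective _⟩)⟩

theorem IsLocallyCompleteIntersectionInCodimLEOne.of_ringEquiv {B B' : Type u} [CommRing B]
    [CommRing B'] (e : B ≃+* B') (hB : IsLocallyCompleteIntersectionInCodimLEOne B) :
    IsLocallyCompleteIntersectionInCodimLEOne B' := fun p _ hp ↦
  (hB (p.comap e) ((e.height_comap p).trans_le hp)).of_ringEquiv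
    (Localization.localRingEquiv (p.comap e) p e rfl)

/-- `B` is locally a complete intersection: `B_𝔭` is a complete intersection for every prime `𝔭`,
of any height. -/
def IsLocallyCompleteIntersection (B : Type u) [CommRing B] : Prop :=
  ∀ (p : Ideal B) [p.IsPrime], IsCompleteIntersectionLocalRing (Localization.AtPrime p)

namespace IsLocallyCompleteIntersection

theorem of_surjective {P B : Type u} [CommRing P] [IsRegularRing P] [CommRing B] (φ : P →+* B)
    (hφ : Function.Surjective φ) {x : List P} (hx : RingTheory.Sequence.IsWeaklyRegular P x)
    (hker : RingHom.ker φ = Ideal.ofList x) : IsLocallyCompleteIntersection B := by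
  intro p _
  let q := p.comap φ
  have map_primeCompl : q.primeCompl.map φ = p.primeCompl :=
    Submonoid.map_comap_eq_of_surjective hφ p.primeCompl
  let ψ := Localization.localRingHom q p φ rfl
  have : IsLocalization (q.primeCompl.map φ) (Localization.AtPrime p) := by
    rw [map_primeCompl]
    infer_instance
  have hψ : Function.Surjective ψ :=
    IsLocalization.map_surjective_of_surjective q.primeCompl _ _ hφ
  have ker_ψ : RingHom.ker ψ =
      Ideal.ofList (x.map (algebraMap P (Localization.AtPrime q))) := by
    rw [← Ideal.map_ofList, ← hker]
    exact IsLocalization.ker_map _ _ map_primeCompl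
  exact .of_surjective ψ hψ (.of_flat hx) ker_ψ

theorem isCompleteIntersectionLocalRing_of_disjoint {B C : Type u} [CommRing B] [CommRing C]
    [Algebra B C] (hC : IsLocallyCompleteIntersection C) (M : Submonoid B) [IsLocalization M C]
    (p : Ideal B) [p.IsPrime] (hp : Disjoint (M : Set B) p) :
    IsCompleteIntersectionLocalRing (Localization.AtPrime p) := by
  let P := p.map (algebraMap B C)
  have : P.IsPrime := IsLocalization.isPrime_of_isPrime_disjoint M C p ‹_› hp
  let T := Localization.AtPrime P
  have under_P : P.under B = p :=
    IsLocalization.under_map_of_isPrime_disjoint M C ‹_› hp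
  have : IsLocalization.AtPrime T (P.under B) :=
    IsLocalization.isLocalization_isLocalization_atPrime_isLocalization M T P
  have : IsLocalization p.primeCompl T := by simpa only [under_P] using this
  exact (hC P).of_ringEquiv
    (IsLocalization.algEquiv p.primeCompl T (Localization.AtPrime p)).toRingEquiv

end IsLocallyCompleteIntersection

end CompleteIntersection

namespace sqrtExtensionSubring

section Presentation

variable {R : Type u} [CommRing R] (a : R)

instance instAlgebra (I : Ideal R) : Algebra R (sqrtExtensionSubring a I) :=
  ((algebraMap R (SqrtExtension R a)).codRestrict _ fun _ ↦ I.zero_mem).toAlgebra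

theorem coe_algebraMap {I : Ideal R} (r : R) :
    (algebraMap R (sqrtExtensionSubring a I) r : SqrtExtension R a) = ⟨r, 0⟩ := rfl

/-- The element `(0, t) = t a^{1/2}` of `R ⊕ tR`. -/
def root (t : R) : sqrtExtensionSubring a (Ideal.span {t}) :=
  ⟨⟨0, t⟩, Ideal.mem_span_singleton_self t⟩

open Polynomial

theorem coe_aeval_root_linear (t r c : R) :
    (aeval (root a t) (C c * X + C r) : SqrtExtension R a) = ⟨r, c * t⟩ := by
  simp only [map_add, map_mul, aeval_C, aeval_X]
  ext <;> simp [root, coe_algebraMap]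

theorem aeval_root_surjective (t : R) : Function.Surjective (aeval (R := R) (root a t)) := by
  rintro ⟨⟨r, s⟩, hs⟩
  obtain ⟨c, rfl⟩ := Ideal.mem_span_singleton'.1 hs
  exact ⟨C c * X + C r, Subtype.ext (coe_aeval_root_linear a t r c)⟩

theorem aeval_root_X_sq_sub_C (t : R) : aeval (root a t) (X ^ 2 - C (t ^ 2 * a)) = 0 := by
  simp only [map_sub, map_pow, aeval_C, aeval_X]
  ext <;> simp [root, coe_algebraMap, pow_two]
  ring

theorem ker_aeval_root {t : R} (ht : t ∈ nonZeroDivisors R) :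
    RingHom.ker (aeval (R := R) (root a t)) = Ideal.span {X ^ 2 - C (t ^ 2 * a)} := by
  nontriviality R
  have monic : (X ^ 2 - C (t ^ 2 * a)).Monic := monic_X_pow_sub_C _ two_ne_zero
  ext g
  rw [Ideal.mem_span_singleton, ← modByMonic_eq_zero_iff_dvd monic, RingHom.mem_ker,
    ← aeval_modByMonic_eq_self_of_root (aeval_root_X_sq_sub_C a t)]
  set r := g %ₘ (X ^ 2 - C (t ^ 2 * a))
  refine ⟨fun hr ↦ ?_, fun hr ↦ by rw [hr, map_zero]⟩
  have degree_r : r.degree ≤ 1 := Order.le_of_lt_succ <|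
    (degree_modByMonic_lt g monic).trans_eq (degree_X_pow_sub_C two_pos _)
  rw [eq_X_add_C_of_degree_le_one degree_r] at hr ⊢
  have coords := congrArg Subtype.val hr
  rw [coe_aeval_root_linear] at coords
  have h₀ : r.coeff 0 = 0 := congrArg QuadraticAlgebra.re coords
  have h₁ : r.coeff 1 = 0 :=
    (mul_right_mem_nonZeroDivisors_eq_zero_iff ht).1 (congrArg QuadraticAlgebra.im coords)
  rw [h₀, h₁, C_0, zero_mul, zero_add]

theorem ker_aeval_root_zero :
    RingHom.ker (aeval (R := R) (root a 0)) = Ideal.span {X} := by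
  ext g
  have root_zero : root a 0 = 0 := rfl
  have injective : Function.Injective (algebraMap R (sqrtExtensionSubring a (Ideal.span {0}))) :=
    fun r s h ↦ congrArg (fun z ↦ z.1.re) h
  rw [Ideal.mem_span_singleton, X_dvd_iff, RingHom.mem_ker, root_zero, ← coeff_zero_eq_aeval_zero',
    map_eq_zero_iff _ injective]

theorem isLocallyCompleteIntersection [IsDomain R] [IsPrincipalIdealRing R] (I : Ideal R) :
    IsLocallyCompleteIntersection (sqrtExtensionSubring a I) := by
  obtain ⟨t, rfl⟩ := IsPrincipalIdealRing.principal I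
  obtain ⟨f, hf, hker⟩ : ∃ f : R[X], f ≠ 0 ∧
      RingHom.ker (aeval (R := R) (root a t)) = Ideal.span {f} := by
    by_cases ht : t = 0
    · subst ht
      exact ⟨X, X_ne_zero, ker_aeval_root_zero a⟩
    · exact ⟨X ^ 2 - C (t ^ 2 * a), X_pow_sub_C_ne_zero two_pos _,
        ker_aeval_root a (mem_nonZeroDivisors_of_ne_zero ht)⟩
  exact .of_surjective (aeval (R := R) (root a t)).toRingHom (aeval_root_surjective a t) (x := [f])
    ((RingTheory.Sequence.isWeaklyRegular_singleton_iff _ f).2 (.of_ne_zero hf))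
    (hker.trans (Ideal.ofList_singleton f).symm)

end Presentation

section Localization

variable {R D : Type*} [CommRing R] [CommRing D] [Algebra R D] (a : R) (I : Ideal R)

/-- The ring homomorphism `R ⊕ I → D ⊕ ID` induced by `R → D`. -/
def baseChange : sqrtExtensionSubring a I →+*
    sqrtExtensionSubring (algebraMap R D a) (I.map (algebraMap R D)) where
  toFun z := ⟨⟨algebraMap R D z.1.re, algebraMap R D z.1.im⟩, Ideal.mem_map_of_mem _ z.2⟩
  map_one' := by ext <;> simp [QuadraticAlgebra.re_one, QuadraticAlgebra.im_one]
  map_zero' := by ext <;> simp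
  map_add' z w := by ext <;> simp
  map_mul' z w := by ext <;> simp

instance instAlgebraBaseChange : Algebra (sqrtExtensionSubring a I)
    (sqrtExtensionSubring (algebraMap R D a) (I.map (algebraMap R D))) :=
  (baseChange a I).toAlgebra

theorem algebraMap_algebraMap (r : R) :
    algebraMap (sqrtExtensionSubring a I)
      (sqrtExtensionSubring (algebraMap R D a) (I.map (algebraMap R D))) (algebraMap R _ r) =
        algebraMap D _ (algebraMap R D r) :=
  Subtype.ext (QuadraticAlgebra.ext rfl (map_zero (algebraMap R D)))

theorem coe_algebraMap_mk {r s : R} (hs : s ∈ I) :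
    (algebraMap (sqrtExtensionSubring a I)
      (sqrtExtensionSubring (algebraMap R D a) (I.map (algebraMap R D))) ⟨⟨r, s⟩, hs⟩ :
        SqrtExtension D (algebraMap R D a)) = ⟨algebraMap R D r, algebraMap R D s⟩ := rfl

instance isLocalization_baseChange (M : Submonoid R) [IsLocalization M D] :
    IsLocalization (Algebra.algebraMapSubmonoid (sqrtExtensionSubring a I) M)
      (sqrtExtensionSubring (algebraMap R D a) (I.map (algebraMap R D))) := by
  refine ⟨?_, ?_, ?_⟩
  · rintro ⟨_, s, hs, rfl⟩
    rw [algebraMap_algebraMap]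
    exact (IsLocalization.map_units D ⟨s, hs⟩).map (algebraMap D _)
  · rintro ⟨⟨x, y⟩, hy⟩
    obtain ⟨⟨r, s⟩, hx⟩ := IsLocalization.surj M x
    obtain ⟨⟨i, s'⟩, hi⟩ := (IsLocalization.mem_map_algebraMap_iff M D).1 hy
    refine ⟨⟨⟨⟨s' * r, s * i⟩, I.mul_mem_left _ i.2⟩, ⟨_, s * s', (s * s').2, rfl⟩⟩, ?_⟩
    rw [algebraMap_algebraMap]
    apply Subtype.ext
    rw [Subring.coe_mul, coe_algebraMap, SqrtExtension.mk_mul_mk, coe_algebraMap_mk]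
    simp only [map_mul, ← hx, ← hi]
    ext <;> ring
  · rintro ⟨⟨r, i⟩, hi⟩ ⟨⟨r', i'⟩, hi'⟩ h
    obtain ⟨s, hs⟩ := IsLocalization.exists_of_eq (M := M) (S := D)
      (congrArg (fun z ↦ z.1.re) h)
    obtain ⟨s', hs'⟩ := IsLocalization.exists_of_eq (M := M) (S := D)
      (congrArg (fun z ↦ z.1.im) h)
    refine ⟨⟨_, s * s', (s * s').2, rfl⟩, Subtype.ext ?_⟩
    simp only [Subring.coe_mul, coe_algebraMap, SqrtExtension.mk_mul_mk]
    ext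
    · linear_combination s' * hs
    · linear_combination s * hs'

end Localization

end sqrtExtensionSubring

section Height

variable {R B T : Type*} [CommRing R] [CommRing B] [CommRing T]

theorem height_le_height_of_liesOver_of_isIntegral [Algebra B T] [Algebra.IsIntegral B T]
    (p : Ideal B) (P : Ideal T) [P.IsPrime] [P.LiesOver p] : P.height ≤ p.height := by
  have strictMono : StrictMono (PrimeSpectrum.comap (algebraMap B T)) := fun _ _ h ↦
    Ideal.IsIntegral.comap_lt_comap h
  have := Order.height_le_height_apply_of_strictMono _ strictMono ⟨P, ‹_›⟩
  rw [← PrimeSpectrum.height_eq_orderHeight, ← PrimeSpectrum.height_eq_orderHeight] at this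
  rwa [P.over_def p]

theorem height_under_le_height_of_hasGoingDown [IsNoetherianRing R] [IsNoetherianRing T]
    [Algebra R B] [Algebra B T] [Algebra R T] [IsScalarTower R B T] [Algebra.HasGoingDown R T]
    [Algebra.IsIntegral B T] [FaithfulSMul B T] (p : Ideal B) [p.IsPrime] :
    (p.under R).height ≤ p.height := by
  obtain ⟨⟨P, _, _⟩⟩ := Ideal.nonempty_primesOver (S := T) p
  have : P.LiesOver (p.under R) := .trans P p (p.under R)
  calc (p.under R).height ≤ P.height := by
        rw [Ideal.height_eq_height_add_of_liesOver_of_hasGoingDown (p.under R) P]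
        exact le_self_add
    _ ≤ p.height := height_le_height_of_liesOver_of_isIntegral p P

theorem isPrincipalIdealRing_localizationAtPrime_of_height_le_one {R : Type*} [CommRing R]
    [IsDomain R] [IsNoetherianRing R] [IsIntegrallyClosed R] (q : Ideal R) [q.IsPrime]
    (hq : q.height ≤ 1) : IsPrincipalIdealRing (Localization.AtPrime q) := by
  have : IsIntegrallyClosed (Localization.AtPrime q) :=
    isIntegrallyClosed_of_isLocalization _ q.primeCompl q.primeCompl_le_nonZeroDivisors
  have : Ring.KrullDimLE 1 (Localization.AtPrime q) := by
    rw [Ring.krullDimLE_iff, IsLocalization.AtPrime.ringKrullDim_eq_height q]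
    exact_mod_cast hq
  have : Ring.DimensionLEOne (Localization.AtPrime q) := ⟨fun hP hP' ↦ hP'.isMaximal_of_ne_bot hP⟩
  have : IsDedekindDomain (Localization.AtPrime q) := {}
  infer_instance

end Height

namespace sqrtExtensionSubring

variable {R : Type u} [CommRing R]

theorem height_under_le_height [IsNoetherianRing R] (a : R) (I : Ideal R)
    (p : Ideal (sqrtExtensionSubring a I)) [p.IsPrime] : (p.under R).height ≤ p.height := by
  have : IsScalarTower R (sqrtExtensionSubring a I) (SqrtExtension R a) :=
    .of_algebraMap_eq fun _ ↦ rfl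
  have : Algebra.IsIntegral (sqrtExtensionSubring a I) (SqrtExtension R a) :=
    Algebra.IsIntegral.tower_top R
  have : IsNoetherianRing (SqrtExtension R a) := IsNoetherianRing.of_finite R _
  exact height_under_le_height_of_hasGoingDown (T := SqrtExtension R a) p

theorem isLocallyCompleteIntersectionInCodimLEOne [IsDomain R] [IsNoetherianRing R]
    [IsIntegrallyClosed R] (a : R) (I : Ideal R) :
    IsLocallyCompleteIntersectionInCodimLEOne (sqrtExtensionSubring a I) := by
  intro p _ hp
  let q := p.under R
  let D := Localization.AtPrime q
  let M := Algebra.algebraMapSubmonoid (sqrtExtensionSubring a I) q.primeCompl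
  have : IsPrincipalIdealRing D :=
    isPrincipalIdealRing_localizationAtPrime_of_height_le_one q
      ((height_under_le_height a I p).trans hp)
  have disjoint : Disjoint (M : Set (sqrtExtensionSubring a I)) p := by
    rw [Set.disjoint_left]
    rintro _ ⟨s, hs, rfl⟩ hsp
    exact hs hsp
  have isLocallyCompleteIntersection_localization :=
    isLocallyCompleteIntersection (algebraMap R D a) (I.map (algebraMap R D))
  exact isLocallyCompleteIntersection_localization.isCompleteIntersectionLocalRing_of_disjoint
    M p disjoint

theorem top_eq_top (a : R) : sqrtExtensionSubring a ⊤ = ⊤ :=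
  top_unique fun z _ ↦ (Submodule.mem_top : z.im ∈ (⊤ : Ideal R))

end sqrtExtensionSubring

theorem lemma3p3_general {R : Type u} [CommRing R] [IsDomain R] [IsNoetherianRing R]
    [IsIntegrallyClosed R] (I : Ideal R) (a : R) :
    IsLocallyCompleteIntersectionInCodimLEOne (SqrtExtension R a) ∧
      IsLocallyCompleteIntersectionInCodimLEOne (sqrtExtensionSubring a I) := by
  let equivTop : sqrtExtensionSubring a ⊤ ≃+* SqrtExtension R a :=
    (RingEquiv.subringCongr (sqrtExtensionSubring.top_eq_top a)).trans Subring.topEquiv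
  have isCI (J : Ideal R) :=
    sqrtExtensionSubring.isLocallyCompleteIntersectionInCodimLEOne a J
  exact ⟨(isCI ⊤).of_ringEquiv equivTop, isCI I⟩

theorem lemma3p3 {R : Type u} [CommRing R] [IsDomain R] [IsNoetherianRing R] [IsLocalRing R]
    [IsIntegrallyClosed R] (ω : Ideal R) (hω : IsCanonicalIdeal ω)
    (a : R) (ha : a ∈ maximalIdeal R) (hsq : ¬ IsSquare (algebraMap R (FractionRing R) a)) :
    IsLocallyCompleteIntersectionInCodimLEOne (SqrtExtension R a) ∧
      IsLocallyCompleteIntersectionInCodimLEOne (sqrtExtensionSubring a ω) :=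
  lemma3p3_general ω a
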